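/- Let $0\le k\le n$ and $m\ge 1$ be integers. Let $G_{n,k}$ be the Grassmannian of $k$-dimensional linear subspaces of $\mathbb R^n$, equipped with its rotation-invariant (Haar) probability measure $dE$. For a real number $p\neq 0$ and a function $f$ on a measure space $(X,\mu)$ put $\|f\|_p=\left(\int_X |f|^p\,d\mu\right)^{1/p}\in[0,\infty]$, and write $f\in L^p$ if $f$ is measurable and $\int_X|f|^p\,d\mu<\infty$. Let $p_1,\dots,p_m$ and $\alpha_1,\dots,\alpha_m$ be real numbers, $p_i\ne 0$, with $\sum_{i=1}^m \alpha_i/p_i=n$, and let $f_1,\dots,f_m:\mathbb R^n\to\mathbb R$ be bounded functions with $f_i\in L^{p_i}(\mathbb R^n)$. Define $$I(f_1,\dots,f_m)=\int_{G_{n,k}}\prod_{i=1}^m \big\|f_i|_E\big\|_{p_i}^{\alpha_i}\,dE\in[0,\infty],$$ where $f_i|_E$ is the restriction of $f_i$ to $E$, the norm $\|f_i|_E\|_{p_i}$ is taken with respect to $k$-dimensional Lebesgue measure on $E$, and $0\cdot\infty=0$ in the product. If $I(f_1,\dots,f_m)<\infty$, then for every volume-preserving linear transformation $g$ of $\mathbb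 R^n$ (that is, $|\det g|=1$; in particular for every $g\in SL(n)$), $$I(f_1\circ g^{-1},\dots,f_m\circ g^{-1})=I(f_1,\dots,f_m).$$ -/

import Mathlib

open MeasureTheory Module
open scoped ENNReal

noncomputable section

/-- The Grassmannian `G_{n,k}` of `k`-dimensional linear subspaces of Euclidean space `ℝⁿ`. -/
def Gr (n k : ℕ) : Type :=
  {E : Submodule ℝ (EuclideanSpace ℝ (Fin n)) // finrank ℝ E = k}

namespace Gr

/-- The usual topology of the Grassmannian: a subspace is identified with the orthogonal
projection onto it. -/
instance instTopologicalSpace (n k : ℕ) : TopologicalSpace (Gr n k) :=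
  TopologicalSpace.induced (fun E => E.1.starProjection) inferInstance

/-- The Grassmannian carries its Borel σ-algebra. -/
instance instMeasurableSpace (n k : ℕ) : MeasurableSpace (Gr n k) := borel _

instance instBorelSpace (n k : ℕ) : BorelSpace (Gr n k) := ⟨rfl⟩

end Gr

/-- The orthogonal group `O(n)`, as the group of linear operators `U` on `ℝⁿ` such that
`U* U = U U* = 1`. -/
abbrev OrthGroup (n : ℕ) : Type :=
  unitary (EuclideanSpace ℝ (Fin n) →L[ℝ] EuclideanSpace ℝ (Fin n))

instance OrthGroup.instContinuousStar (n : ℕ) :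
    ContinuousStar (EuclideanSpace ℝ (Fin n) →L[ℝ] EuclideanSpace ℝ (Fin n)) :=
  ⟨ContinuousLinearMap.adjoint.continuous⟩

instance OrthGroup.instCompactSpace (n : ℕ) : CompactSpace (OrthGroup n) := by
  apply isCompact_iff_compactSpace.mp
  refine Metric.isCompact_of_isClosed_isBounded isClosed_unitary ?_
  refine (Metric.isBounded_closedBall
    (x := (0 : EuclideanSpace ℝ (Fin n) →L[ℝ] EuclideanSpace ℝ (Fin n))) (r := 1)).subset ?_
  intro U hU
  rw [mem_closedBall_zero_iff]
  refine ContinuousLinearMap.opNorm_le_bound _ zero_le_one fun x => ?_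
  rw [one_mul]
  exact ((Unitary.linearIsometryEquiv ⟨U, hU⟩).norm_map x).le

/-- The Haar probability measure of `O(n)`. -/
def OrthGroup.haarProb (n : ℕ) : Measure (OrthGroup n) := Measure.haarMeasure ⊤

instance OrthGroup.instIsProbabilityMeasure (n : ℕ) :
    IsProbabilityMeasure (OrthGroup.haarProb n) :=
  ⟨by simpa [OrthGroup.haarProb] using
    Measure.haarMeasure_self (K₀ := (⊤ : TopologicalSpace.PositiveCompacts (OrthGroup n)))⟩

namespace Gr

/-- The action of `O(n)` on the Grassmannian, `(U, E) ↦ U E`. -/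
def rotate {n k : ℕ} (U : OrthGroup n) (E : Gr n k) : Gr n k :=
  ⟨E.1.map ((Unitary.linearIsometryEquiv U).toLinearEquiv :
      EuclideanSpace ℝ (Fin n) →ₗ[ℝ] EuclideanSpace ℝ (Fin n)),
    ((Unitary.linearIsometryEquiv U).toLinearEquiv.finrank_map_eq E.1).trans E.2⟩

lemma continuous_rotate {n k : ℕ} (E : Gr n k) :
    Continuous fun U : OrthGroup n => rotate U E := by
  refine continuous_induced_rng.2 ?_
  have h : ((fun F : Gr n k => F.1.starProjection) ∘ fun U : OrthGroup n => rotate U E) =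
      fun U : OrthGroup n =>
        (U : EuclideanSpace ℝ (Fin n) →L[ℝ] EuclideanSpace ℝ (Fin n)) * E.1.starProjection *
          ((U⁻¹ : OrthGroup n) : EuclideanSpace ℝ (Fin n) →L[ℝ] EuclideanSpace ℝ (Fin n)) := by
    funext U
    ext1 x
    exact Submodule.starProjection_map_apply (Unitary.linearIsometryEquiv U) E.1 x
  rw [h]
  exact (continuous_subtype_val.mul continuous_const).mul
    (continuous_subtype_val.comp continuous_inv)

/-- The coordinate subspace `ℝ e₁ ⊕ ⋯ ⊕ ℝ e_k`. -/
def coordSubspace {n k : ℕ} (hk : k ≤ n) : Gr n k :=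
  ⟨Submodule.span ℝ (Set.range fun j : Fin k => EuclideanSpace.single (Fin.castLE hk j) (1 : ℝ)), by
    have h : LinearIndependent ℝ
        fun j : Fin k => EuclideanSpace.single (Fin.castLE hk j) (1 : ℝ) := by
      have h0 := (EuclideanSpace.basisFun (Fin n) ℝ).toBasis.linearIndependent.comp
        (Fin.castLE hk) (Fin.castLE_injective hk)
      have h1 : (fun j : Fin k => EuclideanSpace.single (Fin.castLE hk j) (1 : ℝ)) =
          (EuclideanSpace.basisFun (Fin n) ℝ).toBasis ∘ Fin.castLE hk := by
        funext j
        simp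
      rw [h1]
      exact h0
    simpa using finrank_span_eq_card h⟩

/-- The Haar (rotation-invariant) probability measure `μ_{n,k}` of the Grassmannian: the law of
`U E₀`, where `E₀ = ℝ e₁ ⊕ ⋯ ⊕ ℝ e_k` and `U` is distributed according to the Haar probability
measure of `O(n)`. -/
def haar {n k : ℕ} (hk : k ≤ n) : Measure (Gr n k) :=
  (OrthGroup.haarProb n).map fun U => rotate U (coordSubspace hk)

instance instIsProbabilityMeasure {n k : ℕ} (hk : k ≤ n) : IsProbabilityMeasure (haar hk) :=
  Measure.isProbabilityMeasure_map (continuous_rotate _).measurable.aemeasurable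

end Gr

/-- `‖f‖_p = (∫ |f|^p dμ)^(1/p) ∈ [0, ∞]` for a real exponent `p ≠ 0`, with the usual
conventions `0^p = ∞`, `∞^p = 0` for `p < 0`. -/
def realLpNorm {X : Type*} [MeasurableSpace X] (f : X → ℝ) (p : ℝ) (μ : Measure X) : ℝ≥0∞ :=
  (∫⁻ x, ‖f x‖ₑ ^ p ∂μ) ^ (1 / p)

/-- `f ∈ L^p(μ)` for a real exponent `p ≠ 0`: `f` is measurable and `∫ |f|^p dμ < ∞`. -/
def MemRealLp {X : Type*} [MeasurableSpace X] (f : X → ℝ) (p : ℝ) (μ : Measure X) : Prop :=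
  AEStronglyMeasurable f μ ∧ ∫⁻ x, ‖f x‖ₑ ^ p ∂μ < ∞

/-- For positive exponents these are the norm and the `L^p` functions of Mathlib. -/
lemma realLpNorm_eq_eLpNorm {X : Type*} [MeasurableSpace X] (f : X → ℝ) {p : ℝ} (hp : 0 < p)
    (μ : Measure X) : realLpNorm f p μ = eLpNorm f (ENNReal.ofReal p) μ := by
  rw [eLpNorm_eq_lintegral_rpow_enorm_toReal (by simpa using hp) ENNReal.ofReal_ne_top,
    ENNReal.toReal_ofReal hp.le, realLpNorm]

lemma memRealLp_iff_memLp {X : Type*} [MeasurableSpace X] (f : X → ℝ) {p : ℝ} (hp : 0 < p)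
    (μ : Measure X) : MemRealLp f p μ ↔ MemLp f (ENNReal.ofReal p) μ := by
  have h0 : ENNReal.ofReal p ≠ 0 := by simpa using hp
  rw [MemRealLp, MemLp, eLpNorm_lt_top_iff_lintegral_rpow_enorm_lt_top h0 ENNReal.ofReal_ne_top,
    ENNReal.toReal_ofReal hp.le]

/-- `I(f₁, …, f_m) = ∫_{G_{n,k}} ∏ᵢ ‖fᵢ|_E‖_{pᵢ}^{αᵢ} dE ∈ [0, ∞]`, where `‖·‖_{pᵢ}` is taken with
respect to `k`-dimensional Lebesgue measure of the subspace `E`. -/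
def grassmannIntegral {n k m : ℕ} (hk : k ≤ n) (p α : Fin m → ℝ)
    (f : Fin m → EuclideanSpace ℝ (Fin n) → ℝ) : ℝ≥0∞ :=
  ∫⁻ E : Gr n k, ∏ i, realLpNorm (fun t : E.1 => f i t) (p i) volume ^ α i ∂(Gr.haar hk)

end

/-!
Let `Φ` be a function on `Hom(ℝᵏ, ℝⁿ)` with `Φ(XA) = |det A|⁻ⁿ Φ(X)` for `A ∈ GL(k)`. Averaging
over `GL(k)` and exchanging the integrals shows that `∫ w Φ dX` depends on the weight `w` only
through the averages `∫ w(XA) |det A|⁻ᵏ dA`. For `w(X) = (normDet X)ⁿ` on the operator norm unit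
ball these do not depend on the injective map `X`, which is an isometry composed with an element of
`GL(k)`; hence `∫ w(gX) Φ(X) dX = ∫ w(X) Φ(X) dX` for every `g ∈ GL(n)`.

A function `φ` on the Grassmannian gives such a `Φ`, namely `(normDet X)⁻ⁿ φ(X ℝᵏ)`, and then
`∫ w Φ dX` is a multiple of the Haar integral of `φ` by rotation invariance. The substitution
`X ↦ gX` now shows that `g` acts on the Grassmannian with Jacobian `|det g|ᵏ σ_E(g)⁻ⁿ`, where
`σ_E(g)` is the factor by which `g` multiplies volumes in `E`. The power of `σ_E(g)` cancels the
product `∏ σ_E(g)^(αᵢ / pᵢ) = σ_E(g)ⁿ` coming from the norms.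
-/

section Determinants

variable {R M N : Type*} [CommRing R] [AddCommGroup M] [Module R M] [Module.Free R M]
  [Module.Finite R M] [AddCommGroup N] [Module R N] [Module.Free R N] [Module.Finite R N]

theorem det_compRight (g : N →ₗ[R] N) :
    LinearMap.det (g.compRight R : (M →ₗ[R] N) →ₗ[R] (M →ₗ[R] N)) =
      LinearMap.det g ^ finrank R M := by
  nontriviality R
  let b := Free.chooseBasis R M
  have hconj : (b.constr R).symm.toLinearMap ∘ₗ g.compRight R ∘ₗ (b.constr R).toLinearMap =
      LinearMap.pi fun i => g ∘ₗ LinearMap.proj i := by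
    ext x i
    simp [Basis.constr_symm_apply]
  rw [← LinearMap.det_conj _ (b.constr R).symm, LinearEquiv.symm_symm, hconj, LinearMap.det_pi]
  simp [finrank_eq_card_chooseBasisIndex]

theorem det_lcomp (A : M →ₗ[R] M) :
    LinearMap.det (LinearMap.lcomp R N A) = LinearMap.det A ^ finrank R N := by
  nontriviality R
  let c := Free.chooseBasis R N
  let e : (M →ₗ[R] N) ≃ₗ[R] (Free.ChooseBasisIndex R N → Dual R M) :=
    c.equivFun.congrRight ≪≫ₗ (LinearEquiv.linearMapPi R).symm
  have hconj : e.toLinearMap ∘ₗ LinearMap.lcomp R N A ∘ₗ e.symm.toLinearMap =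
      LinearMap.pi fun i => A.dualMap ∘ₗ LinearMap.proj i := by
    refine LinearMap.ext fun l => ?_
    obtain ⟨X, rfl⟩ := e.surjective l
    simp only [LinearMap.comp_apply, LinearEquiv.coe_coe, LinearEquiv.symm_apply_apply]
    rfl
  rw [← LinearMap.det_conj _ e, hconj, LinearMap.det_pi]
  simp [finrank_eq_card_chooseBasisIndex, LinearMap.det_dualMap]

end Determinants

section ChangeOfVariables

theorem lintegral_comp_linearEquiv {E : Type*} [NormedAddCommGroup E] [NormedSpace ℝ E]
    [FiniteDimensional ℝ E] [MeasurableSpace E] [BorelSpace E] (ν : Measure E) [ν.IsAddHaarMeasure]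
    (e : E ≃ₗ[ℝ] E) (f : E → ℝ≥0∞) :
    ∫⁻ x, f (e x) ∂ν = ENNReal.ofReal |LinearMap.det (e : E →ₗ[ℝ] E)|⁻¹ * ∫⁻ x, f x ∂ν := by
  have hmap : ν.map e.toContinuousLinearEquiv.toHomeomorph.toMeasurableEquiv =
      ENNReal.ofReal |(LinearMap.det (e : E →ₗ[ℝ] E))⁻¹| • ν :=
    Measure.map_linearMap_addHaar_eq_smul_addHaar ν e.isUnit_det'.ne_zero
  rw [← abs_inv, ← smul_eq_mul, ← lintegral_smul_measure, ← hmap, lintegral_map_equiv]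
  rfl

theorem lintegral_eq_normDet_mul_lintegral_comp {F V : Type*} [NormedAddCommGroup F]
    [InnerProductSpace ℝ F] [FiniteDimensional ℝ F] [MeasurableSpace F] [BorelSpace F]
    [NormedAddCommGroup V] [InnerProductSpace ℝ V] [FiniteDimensional ℝ V] [MeasurableSpace V]
    [BorelSpace V] (e : F ≃ₗ[ℝ] V) (f : V → ℝ≥0∞) :
    ∫⁻ y, f y = ENNReal.ofReal (e : F →ₗ[ℝ] V).normDet * ∫⁻ x, f (e x) := by
  let e' : F ≃ᵐ V := e.toContinuousLinearEquiv.toHomeomorph.toMeasurableEquiv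
  have hvol : (volume : Measure V) =
      ENNReal.ofReal (e : F →ₗ[ℝ] V).normDet • (volume : Measure F).map e' := by
    ext s -
    have h := (e : F →ₗ[ℝ] V).euclideanHausdorffMeasure_image_eq_normDet_mul_volume (e' ⁻¹' s)
    rw [e.finrank_eq, InnerProductSpace.euclideanHausdorffMeasure_eq_volume] at h
    rw [Measure.smul_apply, smul_eq_mul, e'.map_apply, ← h]
    exact congrArg volume (e'.surjective.image_preimage s).symm
  rw [hvol, lintegral_smul_measure, lintegral_map_equiv, smul_eq_mul]
  rfl

variable {F V : Type*} [NormedAddCommGroup F] [NormedSpace ℝ F] [FiniteDimensional ℝ F]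
  [NormedAddCommGroup V] [NormedSpace ℝ V] [FiniteDimensional ℝ V]

theorem lintegral_comp_postcomp (ν : Measure (F →L[ℝ] V)) [ν.IsAddHaarMeasure] (g : V ≃L[ℝ] V)
    (f : (F →L[ℝ] V) → ℝ≥0∞) :
    ∫⁻ X, f ((g : V →L[ℝ] V) ∘L X) ∂ν =
      ENNReal.ofReal (|(g : V →L[ℝ] V).det|⁻¹ ^ finrank ℝ F) * ∫⁻ X, f X ∂ν := by
  let e : (F →ₗ[ℝ] V) ≃ₗ[ℝ] (F →L[ℝ] V) := LinearMap.toContinuousLinearMap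
  let T : (F →L[ℝ] V) ≃ₗ[ℝ] (F →L[ℝ] V) := e.symm ≪≫ₗ g.toLinearEquiv.congrRight ≪≫ₗ e
  have hT : LinearMap.det (T : (F →L[ℝ] V) →ₗ[ℝ] F →L[ℝ] V) =
      (g : V →L[ℝ] V).det ^ finrank ℝ F :=
    (LinearMap.det_conj _ e).trans (det_compRight _)
  rw [inv_pow, ← abs_pow, ← hT, ← lintegral_comp_linearEquiv ν T f]
  rfl

theorem lintegral_comp_precomp (ν : Measure (F →L[ℝ] V)) [ν.IsAddHaarMeasure] (A : F ≃L[ℝ] F)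
    (f : (F →L[ℝ] V) → ℝ≥0∞) :
    ∫⁻ X, f (X ∘L (A : F →L[ℝ] F)) ∂ν =
      ENNReal.ofReal (|(A : F →L[ℝ] F).det|⁻¹ ^ finrank ℝ V) * ∫⁻ X, f X ∂ν := by
  let e : (F →ₗ[ℝ] V) ≃ₗ[ℝ] (F →L[ℝ] V) := LinearMap.toContinuousLinearMap
  let T : (F →L[ℝ] V) ≃ₗ[ℝ] (F →L[ℝ] V) := e.symm ≪≫ₗ A.symm.toLinearEquiv.congrLeft V ℝ ≪≫ₗ e
  have hT : LinearMap.det (T : (F →L[ℝ] V) →ₗ[ℝ] F →L[ℝ] V) =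
      (A : F →L[ℝ] F).det ^ finrank ℝ V :=
    (LinearMap.det_conj _ e).trans (det_lcomp _)
  rw [inv_pow, ← abs_pow, ← hT, ← lintegral_comp_linearEquiv ν T f]
  rfl

end ChangeOfVariables

section InjectiveMaps

theorem finite_setOf_not_injective_add_smul_id {K V : Type*} [Field K] [AddCommGroup V]
    [Module K V] [FiniteDimensional K V] (A : V →ₗ[K] V) :
    {t : K | ¬ Function.Injective (A + t • LinearMap.id : V →ₗ[K] V)}.Finite := by
  refine (End.finite_spectrum (-A)).subset fun t ht hunit => ht ?_
  have h : algebraMap K (V →ₗ[K] V) t - -A = A + t • LinearMap.id := by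
    rw [sub_neg_eq_add, add_comm]
    rfl
  exact ((End.isUnit_iff _).1 (h ▸ hunit)).injective

theorem ae_injective {F V : Type*} [NormedAddCommGroup F] [NormedSpace ℝ F]
    [FiniteDimensional ℝ F] [NormedAddCommGroup V] [NormedSpace ℝ V] [FiniteDimensional ℝ V]
    (h : finrank ℝ F ≤ finrank ℝ V) (ν : Measure (F →L[ℝ] V)) [ν.IsAddHaarMeasure] :
    ∀ᵐ X : F →L[ℝ] V ∂ν, Function.Injective X := by
  obtain ⟨Y, hY⟩ := finrank_le_iff_exists_linearMap.1 h
  obtain ⟨T, hT⟩ := Y.exists_leftInverse_of_injective (LinearMap.ker_eq_bot.2 hY)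
  have hopen : IsOpen {X : F →L[ℝ] V | Function.Injective X} :=
    ContinuousLinearMap.isOpen_injective
  refine ae_mem_of_ae_add_linearMap_mem
    (LinearMap.toSpanSingleton ℝ (F →L[ℝ] V) (LinearMap.toContinuousLinearMap Y)) volume ν
    hopen.measurableSet fun X => ?_
  have hfin := finite_setOf_not_injective_add_smul_id (T ∘ₗ (X : F →ₗ[ℝ] V))
  filter_upwards [compl_mem_ae_iff.2 (hfin.measure_zero volume)] with t ht
  rw [Set.mem_compl_iff, Set.mem_ofPred_eq, not_not] at ht
  refine Function.Injective.of_comp (f := T) ?_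
  convert ht using 1
  ext x
  simpa using congrArg (t • ·) (LinearMap.congr_fun hT x)

variable {F : Type*} [NormedAddCommGroup F] [NormedSpace ℝ F] [FiniteDimensional ℝ F]

theorem isInvertible_of_injective {A : F →L[ℝ] F} (hA : Function.Injective A) :
    A.IsInvertible :=
  ⟨(LinearEquiv.ofInjectiveEndo (A : F →ₗ[ℝ] F) hA).toContinuousLinearEquiv, rfl⟩

theorem ae_isInvertible (ν : Measure (F →L[ℝ] F)) [ν.IsAddHaarMeasure] :
    ∀ᵐ A ∂ν, A.IsInvertible :=
  (ae_injective le_rfl ν).mono fun _ => isInvertible_of_injective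

theorem measurable_inverse {E F : Type*} [NormedAddCommGroup E] [NormedSpace ℝ E]
    [CompleteSpace E] [NormedAddCommGroup F] [NormedSpace ℝ F] :
    Measurable (ContinuousLinearMap.inverse : (E →L[ℝ] F) → F →L[ℝ] E) := by
  have hopen : IsOpen {A : E →L[ℝ] F | A.IsInvertible} := ContinuousLinearEquiv.isOpen
  have hcont : ContinuousOn ContinuousLinearMap.inverse {A : E →L[ℝ] F | A.IsInvertible} :=
    fun A hA => (hA.contDiffAt_map_inverse (n := 0)).continuousAt.continuousWithinAt
  have hzero : {A : E →L[ℝ] F | A.IsInvertible}ᶜ.domRestrict ContinuousLinearMap.inverse =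
      fun _ => 0 :=
    funext fun A => ContinuousLinearMap.inverse_of_not_isInvertible A.2
  exact measurable_of_restrict_of_restrict_compl hopen.measurableSet
    hcont.domRestrict.measurable (hzero ▸ measurable_const)

end InjectiveMaps

section RangeProjection

variable {F V : Type*} [NormedAddCommGroup F] [InnerProductSpace ℝ F] [FiniteDimensional ℝ F]
  [NormedAddCommGroup V] [InnerProductSpace ℝ V] [FiniteDimensional ℝ V]

theorem starProjection_range {X : F →L[ℝ] V} (hX : Function.Injective X) :
    X.range.starProjection = X ∘L (X.adjoint ∘L X).inverse ∘L X.adjoint := by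
  have hinv : (X.adjoint ∘L X).IsInvertible :=
    isInvertible_of_injective (X.adjoint_comp_self_injective_iff.2 hX)
  ext1 v
  refine Submodule.eq_starProjection_of_mem_orthogonal ⟨_, rfl⟩ ?_
  rw [Submodule.mem_orthogonal]
  rintro _ ⟨y, rfl⟩
  have hnormal : X.adjoint (X ((X.adjoint ∘L X).inverse (X.adjoint v))) = X.adjoint v :=
    hinv.self_apply_inverse _
  change inner ℝ (X y) (v - X ((X.adjoint ∘L X).inverse (X.adjoint v))) = 0
  rw [← ContinuousLinearMap.adjoint_inner_right, map_sub, hnormal, sub_self, inner_zero_right]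

theorem continuousOn_starProjection_range :
    ContinuousOn (fun X : F →L[ℝ] V => X.range.starProjection) {X | Function.Injective X} := by
  refine ContinuousOn.congr (fun X hX => ?_) fun X hX => starProjection_range hX
  have hinv : (X.adjoint ∘L X).IsInvertible :=
    isInvertible_of_injective (X.adjoint_comp_self_injective_iff.2 hX)
  have hadj : Continuous fun X : F →L[ℝ] V => X.adjoint := ContinuousLinearMap.adjoint.continuous
  have hgram : ContinuousAt (fun X : F →L[ℝ] V => (X.adjoint ∘L X).inverse) X :=
    (hinv.contDiffAt_map_inverse (n := 0)).continuousAt.comp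
      (f := fun X : F →L[ℝ] V => X.adjoint ∘L X) (hadj.clm_comp continuous_id).continuousAt
  exact (continuousAt_id.clm_comp (hgram.clm_comp hadj.continuousAt)).continuousWithinAt

end RangeProjection

section DetHomogeneous

theorem lintegral_comp_mul_eq {α : Type*} [MeasurableSpace α] {μ : Measure α} {T : α → α}
    {r : ℝ≥0∞} (hr₀ : r ≠ 0) (hr : r ≠ ∞)
    (hT : ∀ f : α → ℝ≥0∞, ∫⁻ x, f (T x) ∂μ = r * ∫⁻ x, f x ∂μ)
    {Φ : α → ℝ≥0∞} (hΦ : ∀ x, Φ (T x) = r * Φ x) (Ψ : α → ℝ≥0∞) :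
    ∫⁻ x, Ψ (T x) * Φ x ∂μ = ∫⁻ x, Ψ x * Φ x ∂μ := by
  rw [← ENNReal.mul_right_inj hr₀ hr, ← hT fun x => Ψ x * Φ x, ← lintegral_const_mul' _ _ hr]
  simp only [hΦ, mul_left_comm]

theorem lintegral_lintegral_mul_eq {α β : Type*} [MeasurableSpace α] [MeasurableSpace β]
    {μ : Measure α} {η : Measure β} {G : α → ℝ≥0∞} (hG : Measurable G) {K : α → β → ℝ≥0∞}
    (hK : ∀ x, Measurable (K x)) {c : ℝ≥0∞} (h : ∀ᵐ x ∂μ, ∫⁻ y, K x y ∂η = c) :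
    ∫⁻ x, ∫⁻ y, G x * K x y ∂η ∂μ = c * ∫⁻ x, G x ∂μ := by
  rw [← lintegral_const_mul _ hG]
  refine lintegral_congr_ae (h.mono fun x hx => ?_)
  simp only [lintegral_const_mul _ (hK x), hx, mul_comm]

theorem ofReal_inv_abs_det_pow_ne_zero {F : Type*} [NormedAddCommGroup F] [NormedSpace ℝ F]
    (A : F ≃L[ℝ] F) (m : ℕ) : ENNReal.ofReal (|(A : F →L[ℝ] F).det|⁻¹ ^ m) ≠ 0 := by
  have hdet : (A : F →L[ℝ] F).det ≠ 0 := A.toLinearEquiv.isUnit_det'.ne_zero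
  rw [ENNReal.ofReal_ne_zero_iff]
  positivity

variable {F V : Type*} [NormedAddCommGroup F] [NormedSpace ℝ F]
  [NormedAddCommGroup V] [NormedSpace ℝ V]

/-- Functions on `Hom(F, V)` of degree `-dim V` in the determinant of an automorphism of `F`
acting by precomposition; this is the degree for which products with such a function are integrated
by Lebesgue measure independently of that action. -/
def IsDetHomogeneous (Φ : (F →L[ℝ] V) → ℝ≥0∞) : Prop :=
  ∀ (X : F →L[ℝ] V) (A : F ≃L[ℝ] F),
    Φ (X ∘L (A : F →L[ℝ] F)) =
      ENNReal.ofReal (|(A : F →L[ℝ] F).det|⁻¹ ^ finrank ℝ V) * Φ X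

variable [FiniteDimensional ℝ F] [FiniteDimensional ℝ V]

theorem IsDetHomogeneous.lintegral_comp_mul {Φ : (F →L[ℝ] V) → ℝ≥0∞} (hΦ : IsDetHomogeneous Φ)
    (ν : Measure (F →L[ℝ] V)) [ν.IsAddHaarMeasure] (Ψ : (F →L[ℝ] V) → ℝ≥0∞) (A : F ≃L[ℝ] F) :
    ∫⁻ X, Ψ (X ∘L (A : F →L[ℝ] F)) * Φ X ∂ν = ∫⁻ X, Ψ X * Φ X ∂ν :=
  lintegral_comp_mul_eq (ofReal_inv_abs_det_pow_ne_zero A _) ENNReal.ofReal_ne_top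
    (lintegral_comp_precomp ν A) (fun X => hΦ X A) Ψ

theorem IsDetHomogeneous.mul_lintegral_eq_of_average_eq {Φ : (F →L[ℝ] V) → ℝ≥0∞}
    (hΦ : IsDetHomogeneous Φ) (hΦm : Measurable Φ) (ν : Measure (F →L[ℝ] V)) [ν.IsAddHaarMeasure]
    {η : Measure (F →L[ℝ] F)} [SFinite η] (hη : ∀ᵐ A ∂η, A.IsInvertible)
    {H₁ H₂ : (F →L[ℝ] V) → ℝ≥0∞} (hH₁ : Measurable H₁) (hH₂ : Measurable H₂) {c₁ c₂ : ℝ≥0∞}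
    (h₁ : ∀ᵐ X ∂ν, ∫⁻ A, H₁ (X ∘L A.inverse) ∂η = c₁)
    (h₂ : ∀ᵐ X ∂ν, ∫⁻ A, H₂ (X ∘L A) ∂η = c₂) :
    c₂ * ∫⁻ X, H₁ X * Φ X ∂ν = c₁ * ∫⁻ X, H₂ X * Φ X ∂ν := by
  have hm₁ : Measurable fun X => H₁ X * Φ X := hH₁.mul hΦm
  have hm₂ : Measurable fun X => H₂ X * Φ X := hH₂.mul hΦm
  have hcomp : Measurable fun q : (F →L[ℝ] V) × (F →L[ℝ] F) => q.1 ∘L q.2 :=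
    (continuous_fst.clm_comp continuous_snd).measurable
  have hinv : Measurable fun q : (F →L[ℝ] V) × (F →L[ℝ] F) => q.1 ∘L q.2.inverse :=
    hcomp.comp (measurable_fst.prodMk (measurable_inverse.comp measurable_snd))
  have hswap (A : F →L[ℝ] F) (hA : A.IsInvertible) :
      ∫⁻ X, H₁ X * Φ X * H₂ (X ∘L A) ∂ν = ∫⁻ X, H₂ X * Φ X * H₁ (X ∘L A.inverse) ∂ν := by
    obtain ⟨e, rfl⟩ := hA
    have h := hΦ.lintegral_comp_mul ν (fun X => H₂ X * H₁ (X ∘L (e.symm : F →L[ℝ] F))) e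
    simp only [ContinuousLinearMap.comp_assoc, ContinuousLinearEquiv.coe_comp_coe_symm,
      ContinuousLinearMap.comp_id] at h
    rw [ContinuousLinearMap.inverse_equiv]
    convert h using 3 <;> ring
  calc c₂ * ∫⁻ X, H₁ X * Φ X ∂ν
      = ∫⁻ X, ∫⁻ A, H₁ X * Φ X * H₂ (X ∘L A) ∂η ∂ν :=
        (lintegral_lintegral_mul_eq hm₁
          (fun _ => hH₂.comp (hcomp.comp measurable_prodMk_left)) h₂).symm
    _ = ∫⁻ A, ∫⁻ X, H₁ X * Φ X * H₂ (X ∘L A) ∂ν ∂η :=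
        lintegral_lintegral_swap
          ((hm₁.comp measurable_fst).mul (hH₂.comp hcomp)).aemeasurable
    _ = ∫⁻ A, ∫⁻ X, H₂ X * Φ X * H₁ (X ∘L A.inverse) ∂ν ∂η := lintegral_congr_ae (hη.mono hswap)
    _ = ∫⁻ X, ∫⁻ A, H₂ X * Φ X * H₁ (X ∘L A.inverse) ∂η ∂ν :=
        (lintegral_lintegral_swap
          ((hm₂.comp measurable_fst).mul (hH₁.comp hinv)).aemeasurable).symm
    _ = c₁ * ∫⁻ X, H₂ X * Φ X ∂ν :=
        lintegral_lintegral_mul_eq hm₂ (fun _ => hH₁.comp (hinv.comp measurable_prodMk_left)) h₁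

end DetHomogeneous

section GeneralLinearHaar

variable {F : Type*} [NormedAddCommGroup F] [NormedSpace ℝ F]

theorem measurable_ofReal_inv_abs_det_pow (m : ℕ) :
    Measurable fun A : F →L[ℝ] F => ENNReal.ofReal (|A.det|⁻¹ ^ m) :=
  (ContinuousLinearMap.continuous_det.abs.measurable.inv.pow_const m).ennreal_ofReal

theorem ofReal_inv_abs_det_comp_pow (A B : F →L[ℝ] F) (m : ℕ) :
    ENNReal.ofReal (|(A ∘L B).det|⁻¹ ^ m) =
      ENNReal.ofReal (|A.det|⁻¹ ^ m) * ENNReal.ofReal (|B.det|⁻¹ ^ m) := by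
  have hdet : (A ∘L B).det = A.det * B.det := LinearMap.det_comp _ _
  rw [hdet, abs_mul, mul_inv, mul_pow, ENNReal.ofReal_mul (by positivity)]

variable [FiniteDimensional ℝ F]

variable (F) in
/-- The Haar measure of `GL(F)`, as a measure on all endomorphisms of `F` for which the singular
ones form a null set. -/
noncomputable def glHaar : Measure (F →L[ℝ] F) :=
  Measure.addHaar.withDensity fun A => ENNReal.ofReal (|A.det|⁻¹ ^ finrank ℝ F)

instance : SFinite (glHaar F) := by
  unfold glHaar
  infer_instance

theorem lintegral_glHaar (f : (F →L[ℝ] F) → ℝ≥0∞) :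
    ∫⁻ A, f A ∂glHaar F =
      ∫⁻ A, f A * ENNReal.ofReal (|A.det|⁻¹ ^ finrank ℝ F) ∂Measure.addHaar := by
  rw [glHaar, lintegral_withDensity_eq_lintegral_mul_non_measurable _
    (measurable_ofReal_inv_abs_det_pow _) (ae_of_all _ fun _ => ENNReal.ofReal_lt_top)]
  simp only [Pi.mul_apply, mul_comm]

theorem ae_isInvertible_glHaar : ∀ᵐ A ∂glHaar F, A.IsInvertible :=
  (withDensity_absolutelyContinuous _ _).ae_le (ae_isInvertible _)

theorem lintegral_glHaar_mul_left (R : F ≃L[ℝ] F) (f : (F →L[ℝ] F) → ℝ≥0∞) :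
    ∫⁻ A, f ((R : F →L[ℝ] F) ∘L A) ∂glHaar F = ∫⁻ A, f A ∂glHaar F := by
  rw [lintegral_glHaar, lintegral_glHaar]
  exact lintegral_comp_mul_eq (ofReal_inv_abs_det_pow_ne_zero R _) ENNReal.ofReal_ne_top
    (lintegral_comp_postcomp _ R) (fun A => ofReal_inv_abs_det_comp_pow _ A _) f

theorem lintegral_glHaar_mul_right (R : F ≃L[ℝ] F) (f : (F →L[ℝ] F) → ℝ≥0∞) :
    ∫⁻ A, f (A ∘L (R : F →L[ℝ] F)) ∂glHaar F = ∫⁻ A, f A ∂glHaar F := by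
  have hhom : IsDetHomogeneous fun A : F →L[ℝ] F => ENNReal.ofReal (|A.det|⁻¹ ^ finrank ℝ F) :=
    fun A R => (ofReal_inv_abs_det_comp_pow A _ _).trans (mul_comm _ _)
  rw [lintegral_glHaar, lintegral_glHaar]
  exact hhom.lintegral_comp_mul _ f R

end GeneralLinearHaar

section BallWeight

variable {F V : Type*} [NormedAddCommGroup F] [InnerProductSpace ℝ F] [FiniteDimensional ℝ F]
  [NormedAddCommGroup V] [InnerProductSpace ℝ V]

theorem normDet_pos_of_injective {f : F →ₗ[ℝ] V} (hf : Function.Injective f) : 0 < f.normDet :=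
  f.normDet_nonneg.lt_of_ne' ((f.normDet_ne_zero_tfae.out 0 4).2 hf)

theorem normDet_comp_endomorphism (f : F →ₗ[ℝ] V) (A : F →ₗ[ℝ] F) :
    (f ∘ₗ A).normDet = f.normDet * |LinearMap.det A| := by
  rw [LinearMap.normDet_comp_of_finrank_eq _ _ rfl, LinearMap.normDet_eq_abs_det]

theorem exists_isometry_comp_of_injective {X : F →L[ℝ] V} (hX : Function.Injective X) :
    ∃ (Q : F →ₗᵢ[ℝ] V) (R : F ≃L[ℝ] F), X = Q.toContinuousLinearMap ∘L (R : F →L[ℝ] F) := by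
  let e : F ≃ₗ[ℝ] X.range := LinearEquiv.ofInjective (X : F →ₗ[ℝ] V) hX
  let Q : F ≃ₗᵢ[ℝ] X.range := (stdOrthonormalBasis ℝ F).equiv (stdOrthonormalBasis ℝ X.range)
    (finCongr e.finrank_eq)
  refine ⟨X.range.subtypeₗᵢ.comp Q.toLinearIsometry,
    (e.trans Q.symm.toLinearEquiv).toContinuousLinearEquiv, ?_⟩
  ext1 x
  exact (congrArg Subtype.val (Q.apply_symm_apply (e x))).symm

/-- The `m`-th power of the norm determinant, cut off to the unit ball of the operator norm: an
isometry-invariant weight on `Hom(F, V)` against which homogeneous functions are integrated. -/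
noncomputable def ballWeight (m : ℕ) : (F →L[ℝ] V) → ℝ≥0∞ :=
  (Metric.closedBall 0 1).indicator fun X => ENNReal.ofReal ((X : F →ₗ[ℝ] V).normDet ^ m)

theorem ballWeight_isometry_comp (m : ℕ) (Q : F →ₗᵢ[ℝ] V) (B : F →L[ℝ] F) :
    ballWeight m (Q.toContinuousLinearMap ∘L B) = ballWeight m B := by
  have hnorm : ‖Q.toContinuousLinearMap ∘L B‖ = ‖B‖ := Q.norm_toContinuousLinearMap_comp
  have hdet : (Q.toContinuousLinearMap ∘L B : F →ₗ[ℝ] V).normDet = (B : F →ₗ[ℝ] F).normDet := by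
    refine (normDet_comp_endomorphism Q.toLinearMap B).trans ?_
    rw [Q.normDet_eq_one, one_mul, LinearMap.normDet_eq_abs_det]
  simp only [ballWeight, Set.indicator, mem_closedBall_zero_iff, hnorm, hdet]

theorem lintegral_ballWeight_comp (m : ℕ) {X : F →L[ℝ] V} (hX : Function.Injective X) :
    ∫⁻ A, ballWeight m (X ∘L A) ∂glHaar F = ∫⁻ A, ballWeight m A ∂glHaar F := by
  obtain ⟨Q, R, rfl⟩ := exists_isometry_comp_of_injective hX
  simp only [ContinuousLinearMap.comp_assoc, ballWeight_isometry_comp]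
  exact lintegral_glHaar_mul_left R _

theorem lintegral_ballWeight_comp_inverse (m : ℕ) {X : F →L[ℝ] V} (hX : Function.Injective X) :
    ∫⁻ A, ballWeight m (X ∘L A.inverse) ∂glHaar F = ∫⁻ A, ballWeight m A.inverse ∂glHaar F := by
  obtain ⟨Q, R, rfl⟩ := exists_isometry_comp_of_injective hX
  simp only [ContinuousLinearMap.comp_assoc, ballWeight_isometry_comp]
  rw [← lintegral_glHaar_mul_right R.symm fun A => ballWeight m A.inverse]
  simp only [ContinuousLinearMap.inverse_comp_equiv, ContinuousLinearEquiv.symm_symm]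

variable [FiniteDimensional ℝ V]

theorem continuous_normDet : Continuous fun X : F →L[ℝ] V => (X : F →ₗ[ℝ] V).normDet := by
  have h : (fun X : F →L[ℝ] V => (X : F →ₗ[ℝ] V).normDet) = fun X => √(X.adjoint ∘L X).det :=
    funext fun X => ((congrArg Real.sqrt X.normDet_sq).symm.trans
      (Real.sqrt_sq (LinearMap.normDet_nonneg _))).symm
  rw [h]
  exact (ContinuousLinearMap.continuous_det.comp
    (ContinuousLinearMap.adjoint.continuous.clm_comp continuous_id)).sqrt

theorem measurable_ballWeight (m : ℕ) : Measurable (ballWeight m : (F →L[ℝ] V) → ℝ≥0∞) :=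
  (continuous_normDet.pow m).measurable.ennreal_ofReal.indicator
    Metric.isClosed_closedBall.measurableSet

theorem lintegral_ballWeight_glHaar_ne_top {m : ℕ} (hm : finrank ℝ F ≤ m) :
    ∫⁻ A, ballWeight m A ∂glHaar F ≠ ∞ := by
  have hle (A : F →L[ℝ] F) : ballWeight m A * ENNReal.ofReal (|A.det|⁻¹ ^ finrank ℝ F) ≤
      (Metric.closedBall 0 1).indicator
        (fun A : F →L[ℝ] F => ENNReal.ofReal (|A.det| ^ (m - finrank ℝ F))) A := by
    rw [ballWeight, ← Set.indicator_mul_const]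
    refine Set.indicator_le_indicator ?_
    rw [LinearMap.normDet_eq_abs_det, ← ENNReal.ofReal_mul (by positivity)]
    refine ENNReal.ofReal_le_ofReal ?_
    obtain ⟨j, rfl⟩ := Nat.exists_eq_add_of_le' hm
    rw [Nat.add_sub_cancel, pow_add, mul_assoc, ← mul_pow]
    exact mul_le_of_le_one_right (by positivity) (pow_le_one₀ (by positivity) mul_inv_le_one)
  have hcont : Continuous fun A : F →L[ℝ] F => |A.det| ^ (m - finrank ℝ F) :=
    ContinuousLinearMap.continuous_det.abs.pow _
  have hint : IntegrableOn (fun A : F →L[ℝ] F => |A.det| ^ (m - finrank ℝ F))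
      (Metric.closedBall 0 1) Measure.addHaar :=
    hcont.continuousOn.integrableOn_compact (isCompact_closedBall _ _)
  rw [lintegral_glHaar]
  refine ((lintegral_mono hle).trans_lt ?_).ne
  rw [lintegral_indicator Metric.isClosed_closedBall.measurableSet]
  exact hint.lintegral_lt_top

theorem lintegral_ballWeight_glHaar_ne_zero (m : ℕ) : ∫⁻ A, ballWeight m A ∂glHaar F ≠ 0 := by
  have hmeas : Measurable fun A : F →L[ℝ] F =>
      ballWeight m A * ENNReal.ofReal (|A.det|⁻¹ ^ finrank ℝ F) :=
    (measurable_ballWeight m).mul (measurable_ofReal_inv_abs_det_pow _)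
  rw [lintegral_glHaar, Ne, lintegral_eq_zero_iff hmeas]
  intro hzero
  refine (Metric.measure_ball_pos Measure.addHaar (0 : F →L[ℝ] F) one_pos).ne' ?_
  refine measure_mono_null (fun A hA => ?_) (ae_iff.1 (hzero.and (ae_isInvertible _)))
  rintro ⟨hA₀, e, rfl⟩
  refine mul_ne_zero ?_ (ofReal_inv_abs_det_pow_ne_zero e _) hA₀
  rw [ballWeight, Set.indicator_of_mem (Metric.ball_subset_closedBall hA)]
  exact (ENNReal.ofReal_pos.2 (pow_pos (normDet_pos_of_injective e.injective) m)).ne'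

theorem IsDetHomogeneous.lintegral_ballWeight_comp_mul {Φ : (F →L[ℝ] V) → ℝ≥0∞}
    (hΦ : IsDetHomogeneous Φ) (hΦm : Measurable Φ) (hFV : finrank ℝ F ≤ finrank ℝ V)
    (ν : Measure (F →L[ℝ] V)) [ν.IsAddHaarMeasure] {m : ℕ} (hm : finrank ℝ F ≤ m)
    (g : V ≃L[ℝ] V) :
    ∫⁻ X, ballWeight m ((g : V →L[ℝ] V) ∘L X) * Φ X ∂ν = ∫⁻ X, ballWeight m X * Φ X ∂ν := by
  have havg (h : V ≃L[ℝ] V) :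
      (∫⁻ A, ballWeight m A ∂glHaar F) *
          ∫⁻ X, ballWeight m ((h : V →L[ℝ] V) ∘L X) * Φ X ∂ν =
        (∫⁻ A, ballWeight m A.inverse ∂glHaar F) * ∫⁻ X, ballWeight m X * Φ X ∂ν := by
    have hcont : Continuous fun X : F →L[ℝ] V => (h : V →L[ℝ] V) ∘L X :=
      continuous_const.clm_comp continuous_id
    exact hΦ.mul_lintegral_eq_of_average_eq hΦm ν ae_isInvertible_glHaar
      ((measurable_ballWeight m).comp hcont.measurable) (measurable_ballWeight m)
      ((ae_injective hFV ν).mono fun X hX =>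
        lintegral_ballWeight_comp_inverse m (X := (h : V →L[ℝ] V) ∘L X) (h.injective.comp hX))
      ((ae_injective hFV ν).mono fun X hX => lintegral_ballWeight_comp m hX)
  refine (ENNReal.mul_right_inj (lintegral_ballWeight_glHaar_ne_zero m)
    (lintegral_ballWeight_glHaar_ne_top hm)).1 ?_
  exact (havg g).trans (havg (ContinuousLinearEquiv.refl ℝ V)).symm

end BallWeight

local notation "𝔼" n:max => EuclideanSpace ℝ (Fin n)

namespace Gr

variable {n k : ℕ}

theorem continuous_starProjection : Continuous fun E : Gr n k => E.1.starProjection :=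
  continuous_induced_dom

instance : T2Space (Gr n k) :=
  T2Space.of_injective_continuous
    (fun _ _ h => Subtype.ext (Submodule.starProjection_inj.1 h)) continuous_starProjection

theorem measurable_iff {α : Type*} [MeasurableSpace α] {f : α → Gr n k} :
    Measurable f ↔ Measurable fun a => (f a).1.starProjection := by
  refine ⟨fun h => continuous_starProjection.measurable.comp h, fun h => ?_⟩
  have hcomap : instMeasurableSpace n k = MeasurableSpace.comap
      (fun E : Gr n k => E.1.starProjection) (borel _) :=
    borel_comap (f := fun E : Gr n k => E.1.starProjection)
  rw [measurable_iff_comap_le, hcomap, MeasurableSpace.comap_comp]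
  exact measurable_iff_comap_le.1 h

/-- The action of linear isomorphisms on the Grassmannian, `(h, E) ↦ h E`. -/
noncomputable def map (h : 𝔼 n ≃L[ℝ] 𝔼 n) (E : Gr n k) : Gr n k :=
  ⟨E.1.map (h : 𝔼 n →L[ℝ] 𝔼 n).toLinearMap, (h.toLinearEquiv.finrank_map_eq E.1).trans E.2⟩

theorem map_symm_map (h : 𝔼 n ≃L[ℝ] 𝔼 n) (E : Gr n k) : map h.symm (map h E) = E :=
  Subtype.ext ((Submodule.map_symm_eq_iff h.toLinearEquiv).2 rfl)

/-- The factor `σ_E(h)` by which a linear isomorphism multiplies `k`-dimensional volumes in `E`. -/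
noncomputable def volumeFactor (h : 𝔼 n ≃L[ℝ] 𝔼 n) (E : Gr n k) : ℝ :=
  ((h : 𝔼 n →L[ℝ] 𝔼 n).toLinearMap.domRestrict E.1).normDet

theorem volumeFactor_pos (h : 𝔼 n ≃L[ℝ] 𝔼 n) (E : Gr n k) : 0 < volumeFactor h E :=
  normDet_pos_of_injective (h.injective.comp Subtype.val_injective)

theorem lintegral_map_eq (h : 𝔼 n ≃L[ℝ] 𝔼 n) (E : Gr n k) (f : 𝔼 n → ℝ≥0∞) :
    ∫⁻ t : (map h E).1, f t = ENNReal.ofReal (volumeFactor h E) * ∫⁻ t : E.1, f (h t) := by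
  let e : E.1 ≃ₗ[ℝ] (map h E).1 := h.toLinearEquiv.submoduleMap E.1
  have hnormDet : (e : E.1 →ₗ[ℝ] (map h E).1).normDet = volumeFactor h E :=
    LinearMap.normDet_codRestrict (p := (map h E).1)
      (f := (h : 𝔼 n →L[ℝ] 𝔼 n).toLinearMap.domRestrict E.1) fun t => ⟨t, t.2, rfl⟩
  rw [← hnormDet]
  exact lintegral_eq_normDet_mul_lintegral_comp e fun t => f t

/-- The range of an injective linear map `ℝᵏ → ℝⁿ`, as a point of the Grassmannian. -/
noncomputable def ofInjective (X : 𝔼 k →L[ℝ] 𝔼 n) (hX : Function.Injective X) : Gr n k :=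
  ⟨X.range, (LinearMap.finrank_range_of_inj hX).trans finrank_euclideanSpace_fin⟩

open Classical in
/-- The range of a linear map `ℝᵏ → ℝⁿ` as a point of the Grassmannian, extended from the injective
maps to all of `Hom(ℝᵏ, ℝⁿ)` by an arbitrary constant on the null set of the other ones. -/
noncomputable def ofMap (hk : k ≤ n) (X : 𝔼 k →L[ℝ] 𝔼 n) : Gr n k :=
  if hX : Function.Injective X then ofInjective X hX else coordSubspace hk

theorem ofMap_of_injective (hk : k ≤ n) {X : 𝔼 k →L[ℝ] 𝔼 n} (hX : Function.Injective X) :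
    ofMap hk X = ofInjective X hX :=
  dif_pos hX

theorem ofMap_of_not_injective (hk : k ≤ n) {X : 𝔼 k →L[ℝ] 𝔼 n} (hX : ¬ Function.Injective X) :
    ofMap hk X = coordSubspace hk :=
  dif_neg hX

theorem exists_isometry_ofMap_eq (hk : k ≤ n) (E : Gr n k) :
    ∃ Q : 𝔼 k →ₗᵢ[ℝ] 𝔼 n, ofMap hk Q.toContinuousLinearMap = E := by
  let b := (stdOrthonormalBasis ℝ E.1).reindex (finCongr E.2)
  let Q : 𝔼 k →ₗᵢ[ℝ] 𝔼 n := E.1.subtypeₗᵢ.comp b.repr.symm.toLinearIsometry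
  refine ⟨Q, (ofMap_of_injective hk Q.injective).trans (Subtype.ext ?_)⟩
  exact (LinearMap.range_comp_of_range_eq_top E.1.subtype
    (LinearMap.range_eq_top.2 b.repr.symm.surjective)).trans E.1.range_subtype

theorem continuousOn_ofMap (hk : k ≤ n) :
    ContinuousOn (ofMap hk) {X : 𝔼 k →L[ℝ] 𝔼 n | Function.Injective X} := by
  have hind : Topology.IsInducing fun E : Gr n k => E.1.starProjection := ⟨rfl⟩
  have hproj {X : 𝔼 k →L[ℝ] 𝔼 n} (hX : Function.Injective X) :
      (ofMap hk X).1.starProjection = X.range.starProjection := by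
    rw [ofMap_of_injective hk hX]
    rfl
  exact hind.continuousOn_iff.2 (continuousOn_starProjection_range.congr fun X hX => hproj hX)

theorem measurable_ofMap (hk : k ≤ n) : Measurable (ofMap hk) := by
  have hopen : IsOpen {X : 𝔼 k →L[ℝ] 𝔼 n | Function.Injective X} :=
    ContinuousLinearMap.isOpen_injective
  have hconst : {X : 𝔼 k →L[ℝ] 𝔼 n | Function.Injective X}ᶜ.domRestrict (ofMap hk) =
      fun _ => coordSubspace hk :=
    funext fun X => ofMap_of_not_injective hk X.2
  exact measurable_of_restrict_of_restrict_compl hopen.measurableSet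
    (continuousOn_ofMap hk).domRestrict.measurable (hconst ▸ measurable_const)

theorem ofMap_comp (hk : k ≤ n) (X : 𝔼 k →L[ℝ] 𝔼 n) (A : 𝔼 k ≃L[ℝ] 𝔼 k) :
    ofMap hk (X ∘L (A : 𝔼 k →L[ℝ] 𝔼 k)) = ofMap hk X := by
  have hiff : Function.Injective (X ∘L (A : 𝔼 k →L[ℝ] 𝔼 k)) ↔ Function.Injective X :=
    Function.Injective.of_comp_iff' X A.bijective
  by_cases hX : Function.Injective X
  · rw [ofMap_of_injective hk hX, ofMap_of_injective hk (hiff.2 hX)]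
    refine Subtype.ext ?_
    exact LinearMap.range_comp_of_range_eq_top _ (LinearMap.range_eq_top.2 A.surjective)
  · rw [ofMap_of_not_injective hk hX, ofMap_of_not_injective hk (hX ∘ hiff.1)]

theorem ofMap_postcomp (hk : k ≤ n) {X : 𝔼 k →L[ℝ] 𝔼 n} (hX : Function.Injective X)
    (h : 𝔼 n ≃L[ℝ] 𝔼 n) : ofMap hk ((h : 𝔼 n →L[ℝ] 𝔼 n) ∘L X) = map h (ofMap hk X) := by
  rw [ofMap_of_injective hk hX]
  exact (ofMap_of_injective hk (h.injective.comp hX)).trans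
    (Subtype.ext (LinearMap.range_comp _ _))

theorem normDet_postcomp (hk : k ≤ n) {X : 𝔼 k →L[ℝ] 𝔼 n} (hX : Function.Injective X)
    (h : 𝔼 n ≃L[ℝ] 𝔼 n) :
    ((h : 𝔼 n →L[ℝ] 𝔼 n) ∘L X).toLinearMap.normDet =
      volumeFactor h (ofMap hk X) * X.toLinearMap.normDet := by
  rw [ofMap_of_injective hk hX]
  exact LinearMap.normDet_comp _ _

end Gr

namespace OrthGroup

variable {n k : ℕ}

instance (n : ℕ) : (haarProb n).IsHaarMeasure := by
  unfold haarProb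
  infer_instance

instance (n : ℕ) : (haarProb n).IsMulRightInvariant where
  map_mul_right_eq_self U := by
    have : IsProbabilityMeasure ((haarProb n).map (· * U)) :=
      Measure.isProbabilityMeasure_map (continuous_mul_const U).measurable.aemeasurable
    have : ((haarProb n).map (· * U)).IsHaarMeasure := Measure.isHaarMeasure_map_mul_right _ U
    exact Measure.isHaarMeasure_eq_of_isProbabilityMeasure _ _

/-- An element of the orthogonal group, as a linear isomorphism. -/
noncomputable def toEquiv (U : OrthGroup n) : 𝔼 n ≃L[ℝ] 𝔼 n :=
  (Unitary.linearIsometryEquiv U).toContinuousLinearEquiv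

theorem abs_det_toEquiv (U : OrthGroup n) : |(U.toEquiv : 𝔼 n →L[ℝ] 𝔼 n).det| = 1 :=
  (LinearMap.normDet_eq_abs_det _).symm.trans
    (Unitary.linearIsometryEquiv U).toLinearIsometry.normDet_eq_one

end OrthGroup

namespace Gr

variable {n k : ℕ}

theorem rotate_eq_map (U : OrthGroup n) (E : Gr n k) : rotate U E = map U.toEquiv E := rfl

theorem rotate_mul (U W : OrthGroup n) (E : Gr n k) : rotate (U * W) E = rotate U (rotate W E) :=
  Subtype.ext (Submodule.map_comp _ _ _)

theorem exists_rotate_eq (E E' : Gr n k) : ∃ U : OrthGroup n, rotate U E = E' := by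
  let L : E.1 ≃ₗᵢ[ℝ] E'.1 := (stdOrthonormalBasis ℝ E.1).equiv (stdOrthonormalBasis ℝ E'.1)
    (finCongr (E.2.trans E'.2.symm))
  let L' : E.1 →ₗᵢ[ℝ] 𝔼 n := E'.1.subtypeₗᵢ.comp L.toLinearIsometry
  let U : OrthGroup n :=
    Unitary.linearIsometryEquiv.symm (L'.extend.toLinearIsometryEquiv rfl)
  have hU (x : E.1) : U.toEquiv x = L x := L'.extend_apply x
  have hle : (rotate U E).1 ≤ E'.1 := by
    rintro _ ⟨x, hx, rfl⟩
    exact (hU ⟨x, hx⟩).symm ▸ (L ⟨x, hx⟩).2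
  exact ⟨U, Subtype.ext (Submodule.eq_of_le_of_finrank_eq hle ((rotate U E).2.trans E'.2.symm))⟩

theorem isQuotientMap_rotate (E : Gr n k) :
    Topology.IsQuotientMap fun U : OrthGroup n => rotate U E :=
  (continuous_rotate E).isClosedMap.isQuotientMap (continuous_rotate E) (exists_rotate_eq E)

theorem continuous_of_continuousOn_comp_ofMap {Y : Type*} [TopologicalSpace Y] (hk : k ≤ n)
    {ψ : Gr n k → Y}
    (hψ : ContinuousOn (fun X => ψ (ofMap hk X)) {X : 𝔼 k →L[ℝ] 𝔼 n | Function.Injective X}) :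
    Continuous ψ := by
  obtain ⟨Q, hQ⟩ := exists_isometry_ofMap_eq hk (coordSubspace hk)
  have hcont : Continuous fun U : OrthGroup n =>
      (U.toEquiv : 𝔼 n →L[ℝ] 𝔼 n) ∘L Q.toContinuousLinearMap :=
    continuous_subtype_val.clm_comp continuous_const
  have hrotate (U : OrthGroup n) :
      ofMap hk ((U.toEquiv : 𝔼 n →L[ℝ] 𝔼 n) ∘L Q.toContinuousLinearMap) =
        rotate U (coordSubspace hk) := by
    rw [ofMap_postcomp hk Q.injective, hQ, rotate_eq_map]
  refine (isQuotientMap_rotate (coordSubspace hk)).continuous_iff.2 ?_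
  exact (hψ.comp_continuous hcont fun U => U.toEquiv.injective.comp Q.injective).congr
    fun U => congrArg ψ (hrotate U)

theorem continuous_map (hk : k ≤ n) (h : 𝔼 n ≃L[ℝ] 𝔼 n) :
    Continuous (map h : Gr n k → Gr n k) := by
  have hcont : Continuous fun X : 𝔼 k →L[ℝ] 𝔼 n => (h : 𝔼 n →L[ℝ] 𝔼 n) ∘L X :=
    continuous_const.clm_comp continuous_id
  refine continuous_of_continuousOn_comp_ofMap hk (ContinuousOn.congr ?_ fun X hX =>
    (ofMap_postcomp hk hX h).symm)
  exact (continuousOn_ofMap hk).comp hcont.continuousOn fun X hX => h.injective.comp hX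

theorem continuous_volumeFactor (hk : k ≤ n) (h : 𝔼 n ≃L[ℝ] 𝔼 n) :
    Continuous (volumeFactor h : Gr n k → ℝ) := by
  have hcont : Continuous fun X : 𝔼 k →L[ℝ] 𝔼 n => (h : 𝔼 n →L[ℝ] 𝔼 n) ∘L X :=
    continuous_const.clm_comp continuous_id
  refine continuous_of_continuousOn_comp_ofMap hk (ContinuousOn.congr ?_ fun X hX =>
    eq_div_of_mul_eq (normDet_pos_of_injective hX).ne' (normDet_postcomp hk hX h).symm)
  exact (continuous_normDet.comp hcont).continuousOn.div continuous_normDet.continuousOn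
    fun X hX => (normDet_pos_of_injective hX).ne'

/-- The action of a linear isomorphism on the Grassmannian, as a measurable equivalence. -/
noncomputable def mapEquiv (hk : k ≤ n) (h : 𝔼 n ≃L[ℝ] 𝔼 n) : Gr n k ≃ᵐ Gr n k where
  toFun := map h
  invFun := map h.symm
  left_inv := map_symm_map h
  right_inv := map_symm_map h.symm
  measurable_toFun := (continuous_map hk h).measurable
  measurable_invFun := (continuous_map hk h.symm).measurable

theorem measurable_rotate {α : Type*} [MeasurableSpace α] {u : α → OrthGroup n} {f : α → Gr n k}
    (hu : Measurable u) (hf : Measurable f) : Measurable fun a => rotate (u a) (f a) := by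
  have hconj : (fun a => (rotate (u a) (f a)).1.starProjection) = fun a =>
      (u a : 𝔼 n →L[ℝ] 𝔼 n) * (f a).1.starProjection * ((u a)⁻¹ : OrthGroup n) := by
    funext a
    ext1 x
    exact Submodule.starProjection_map_apply (Unitary.linearIsometryEquiv (u a)) (f a).1 x
  rw [measurable_iff, hconj]
  exact ((measurable_subtype_coe.comp hu).mul (measurable_iff.1 hf)).mul
    ((continuous_subtype_val.comp continuous_inv).measurable.comp hu)

theorem lintegral_rotate (hk : k ≤ n) {φ : Gr n k → ℝ≥0∞} (hφ : Measurable φ) (E : Gr n k) :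
    ∫⁻ U, φ (rotate U E) ∂OrthGroup.haarProb n = ∫⁻ E, φ E ∂haar hk := by
  obtain ⟨W, rfl⟩ := exists_rotate_eq (coordSubspace hk) E
  rw [haar, lintegral_map hφ (continuous_rotate _).measurable]
  simp only [← rotate_mul]
  exact lintegral_mul_right_eq_self (fun U => φ (rotate U (coordSubspace hk))) W

theorem setLIntegral_rotate_ofMap (hk : k ≤ n) (ν : Measure (𝔼 k →L[ℝ] 𝔼 n))
    [ν.IsAddHaarMeasure] (U : OrthGroup n) (φ : Gr n k → ℝ≥0∞) :
    ∫⁻ X in Metric.closedBall 0 1, φ (rotate U (ofMap hk X)) ∂ν =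
      ∫⁻ X in Metric.closedBall 0 1, φ (ofMap hk X) ∂ν := by
  have hnorm (X : 𝔼 k →L[ℝ] 𝔼 n) : ‖(U.toEquiv : 𝔼 n →L[ℝ] 𝔼 n) ∘L X‖ = ‖X‖ :=
    (Unitary.linearIsometryEquiv U).toLinearIsometry.norm_toContinuousLinearMap_comp
  have hsubst := lintegral_comp_postcomp ν U.toEquiv
    ((Metric.closedBall 0 1).indicator fun X => φ (ofMap hk X))
  rw [OrthGroup.abs_det_toEquiv, inv_one, one_pow, ENNReal.ofReal_one, one_mul] at hsubst
  rw [← lintegral_indicator Metric.isClosed_closedBall.measurableSet,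
    ← lintegral_indicator Metric.isClosed_closedBall.measurableSet, ← hsubst]
  refine lintegral_congr_ae ?_
  filter_upwards [ae_injective (by simpa only [finrank_euclideanSpace_fin] using hk) ν] with X hX
  simp only [Set.indicator, mem_closedBall_zero_iff, hnorm, rotate_eq_map, ofMap_postcomp hk hX]

theorem setLIntegral_ofMap (hk : k ≤ n) (ν : Measure (𝔼 k →L[ℝ] 𝔼 n)) [ν.IsAddHaarMeasure]
    {φ : Gr n k → ℝ≥0∞} (hφ : Measurable φ) :
    ∫⁻ X in Metric.closedBall 0 1, φ (ofMap hk X) ∂ν =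
      ν (Metric.closedBall 0 1) * ∫⁻ E, φ E ∂haar hk := by
  have hmeas : Measurable fun z : OrthGroup n × (𝔼 k →L[ℝ] 𝔼 n) =>
      φ (rotate z.1 (ofMap hk z.2)) :=
    hφ.comp (measurable_rotate measurable_fst ((measurable_ofMap hk).comp measurable_snd))
  calc ∫⁻ X in Metric.closedBall 0 1, φ (ofMap hk X) ∂ν
      = ∫⁻ U, ∫⁻ X in Metric.closedBall 0 1, φ (rotate U (ofMap hk X)) ∂ν
          ∂OrthGroup.haarProb n := by
        simp only [setLIntegral_rotate_ofMap, lintegral_const, measure_univ, mul_one]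
    _ = ∫⁻ X in Metric.closedBall 0 1, ∫⁻ U, φ (rotate U (ofMap hk X))
          ∂OrthGroup.haarProb n ∂ν := lintegral_lintegral_swap hmeas.aemeasurable
    _ = ν (Metric.closedBall 0 1) * ∫⁻ E, φ E ∂haar hk := by
        simp only [lintegral_rotate hk hφ, setLIntegral_const, mul_comm]

end Gr

namespace Gr

variable {n k : ℕ}

/-- The homogeneous function `X ↦ (normDet X)⁻ⁿ φ(X ℝᵏ)` on `Hom(ℝᵏ, ℝⁿ)` attached to a function `φ`
on the Grassmannian: it transports integrals over `G_{n,k}` to Lebesgue integrals. -/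
noncomputable def homogeneousLift (hk : k ≤ n) (φ : Gr n k → ℝ≥0∞) (X : 𝔼 k →L[ℝ] 𝔼 n) : ℝ≥0∞ :=
  ENNReal.ofReal (X.toLinearMap.normDet⁻¹ ^ n) * φ (ofMap hk X)

theorem measurable_homogeneousLift (hk : k ≤ n) {φ : Gr n k → ℝ≥0∞} (hφ : Measurable φ) :
    Measurable (homogeneousLift hk φ) :=
  (continuous_normDet.measurable.inv.pow_const n).ennreal_ofReal.mul
    (hφ.comp (measurable_ofMap hk))

theorem isDetHomogeneous_homogeneousLift (hk : k ≤ n) (φ : Gr n k → ℝ≥0∞) :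
    IsDetHomogeneous (homogeneousLift hk φ) := by
  intro X A
  have hnormDet : (X ∘L (A : 𝔼 k →L[ℝ] 𝔼 k)).toLinearMap.normDet⁻¹ ^ n =
      |(A : 𝔼 k →L[ℝ] 𝔼 k).det|⁻¹ ^ n * X.toLinearMap.normDet⁻¹ ^ n := by
    rw [← mul_pow, ← mul_inv, mul_comm]
    exact congrArg (·⁻¹ ^ n) (normDet_comp_endomorphism _ _)
  rw [homogeneousLift, homogeneousLift, ofMap_comp, hnormDet, ENNReal.ofReal_mul (by positivity),
    mul_assoc, finrank_euclideanSpace_fin]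

theorem homogeneousLift_postcomp (hk : k ≤ n) (φ : Gr n k → ℝ≥0∞) (h : 𝔼 n ≃L[ℝ] 𝔼 n)
    {X : 𝔼 k →L[ℝ] 𝔼 n} (hX : Function.Injective X) :
    homogeneousLift hk φ ((h : 𝔼 n →L[ℝ] 𝔼 n) ∘L X) =
      homogeneousLift hk
        (fun E => ENNReal.ofReal ((volumeFactor h E)⁻¹ ^ n) * φ (map h E)) X := by
  have hpos := normDet_pos_of_injective hX
  rw [homogeneousLift, homogeneousLift, ofMap_postcomp hk hX, normDet_postcomp hk hX, mul_inv_rev,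
    mul_pow, ENNReal.ofReal_mul (by positivity), mul_assoc]

theorem ballWeight_mul_homogeneousLift (hk : k ≤ n) (φ : Gr n k → ℝ≥0∞) {X : 𝔼 k →L[ℝ] 𝔼 n}
    (hX : Function.Injective X) :
    ballWeight n X * homogeneousLift hk φ X =
      (Metric.closedBall 0 1).indicator (fun X => φ (ofMap hk X)) X := by
  classical
  have hpos := normDet_pos_of_injective hX
  rw [ballWeight, homogeneousLift, ← Set.indicator_mul_const, Set.indicator_apply,
    Set.indicator_apply, ← mul_assoc, ← ENNReal.ofReal_mul (by positivity), ← mul_pow,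
    mul_inv_cancel₀ hpos.ne', one_pow, ENNReal.ofReal_one, one_mul]

theorem lintegral_ballWeight_mul_homogeneousLift (hk : k ≤ n) (ν : Measure (𝔼 k →L[ℝ] 𝔼 n))
    [ν.IsAddHaarMeasure] {φ : Gr n k → ℝ≥0∞} (hφ : Measurable φ) :
    ∫⁻ X, ballWeight n X * homogeneousLift hk φ X ∂ν =
      ν (Metric.closedBall 0 1) * ∫⁻ E, φ E ∂haar hk := by
  rw [← setLIntegral_ofMap hk ν hφ, ← lintegral_indicator Metric.isClosed_closedBall.measurableSet]
  exact lintegral_congr_ae ((ae_injective (by simpa only [finrank_euclideanSpace_fin] using hk)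
    ν).mono fun X hX => ballWeight_mul_homogeneousLift hk φ hX)

theorem measurable_volumeFactor_inv_pow (hk : k ≤ n) (h : 𝔼 n ≃L[ℝ] 𝔼 n) :
    Measurable fun E : Gr n k => ENNReal.ofReal ((volumeFactor h E)⁻¹ ^ n) :=
  ((continuous_volumeFactor hk h).measurable.inv.pow_const n).ennreal_ofReal

theorem lintegral_comp_map_of_measurable (hk : k ≤ n) (h : 𝔼 n ≃L[ℝ] 𝔼 n) {φ : Gr n k → ℝ≥0∞}
    (hφ : Measurable φ) :
    ∫⁻ E, ENNReal.ofReal ((volumeFactor h E)⁻¹ ^ n) * φ (map h E) ∂haar hk =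
      ENNReal.ofReal (|(h : 𝔼 n →L[ℝ] 𝔼 n).det|⁻¹ ^ k) * ∫⁻ E, φ E ∂haar hk := by
  let ν : Measure (𝔼 k →L[ℝ] 𝔼 n) := Measure.addHaar
  let ψ (E : Gr n k) : ℝ≥0∞ := ENNReal.ofReal ((volumeFactor h E)⁻¹ ^ n) * φ (map h E)
  have hψ : Measurable ψ :=
    (measurable_volumeFactor_inv_pow hk h).mul (hφ.comp (continuous_map hk h).measurable)
  have hfin : finrank ℝ (𝔼 k) ≤ n := by simpa only [finrank_euclideanSpace_fin] using hk
  have hfin' : finrank ℝ (𝔼 k) ≤ finrank ℝ (𝔼 n) := hfin.trans_eq finrank_euclideanSpace_fin.symm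
  have hlift : ∫⁻ X, ballWeight n X * homogeneousLift hk ψ X ∂ν =
      ENNReal.ofReal (|(h : 𝔼 n →L[ℝ] 𝔼 n).det|⁻¹ ^ k) *
        ∫⁻ X, ballWeight n X * homogeneousLift hk φ X ∂ν :=
    calc ∫⁻ X, ballWeight n X * homogeneousLift hk ψ X ∂ν
        = ∫⁻ X, ballWeight n ((h.symm : 𝔼 n →L[ℝ] 𝔼 n) ∘L (h : 𝔼 n →L[ℝ] 𝔼 n) ∘L X) *
            homogeneousLift hk φ ((h : 𝔼 n →L[ℝ] 𝔼 n) ∘L X) ∂ν := by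
          refine lintegral_congr_ae ((ae_injective hfin' ν).mono fun X hX => ?_)
          simp only [homogeneousLift_postcomp hk φ h hX, ← ContinuousLinearMap.comp_assoc,
            h.coe_symm_comp_coe, ContinuousLinearMap.id_comp, ψ]
      _ = ENNReal.ofReal (|(h : 𝔼 n →L[ℝ] 𝔼 n).det|⁻¹ ^ k) *
            ∫⁻ X, ballWeight n ((h.symm : 𝔼 n →L[ℝ] 𝔼 n) ∘L X) * homogeneousLift hk φ X ∂ν := by
          simpa only [finrank_euclideanSpace_fin] using lintegral_comp_postcomp ν h fun X =>
            ballWeight n ((h.symm : 𝔼 n →L[ℝ] 𝔼 n) ∘L X) * homogeneousLift hk φ X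
      _ = _ := congrArg _ <| (isDetHomogeneous_homogeneousLift hk φ).lintegral_ballWeight_comp_mul
            (measurable_homogeneousLift hk hφ) hfin' ν hfin h.symm
  rw [lintegral_ballWeight_mul_homogeneousLift hk ν hψ,
    lintegral_ballWeight_mul_homogeneousLift hk ν hφ, mul_left_comm] at hlift
  exact (ENNReal.mul_right_inj (Metric.measure_closedBall_pos ν _ one_pos).ne'
    (isCompact_closedBall _ _).measure_lt_top.ne).1 hlift

theorem map_withDensity_volumeFactor (hk : k ≤ n) (h : 𝔼 n ≃L[ℝ] 𝔼 n) :
    ((haar hk).withDensity fun E => ENNReal.ofReal ((volumeFactor h E)⁻¹ ^ n)).map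
        (mapEquiv hk h) =
      ENNReal.ofReal (|(h : 𝔼 n →L[ℝ] 𝔼 n).det|⁻¹ ^ k) • haar hk := by
  refine Measure.ext_of_lintegral _ fun φ hφ => ?_
  rw [lintegral_map hφ (mapEquiv hk h).measurable, lintegral_smul_measure, smul_eq_mul,
    ← lintegral_comp_map_of_measurable hk h hφ]
  exact lintegral_withDensity_eq_lintegral_mul _ (measurable_volumeFactor_inv_pow hk h)
    (hφ.comp (mapEquiv hk h).measurable)

theorem lintegral_comp_map (hk : k ≤ n) (h : 𝔼 n ≃L[ℝ] 𝔼 n) (φ : Gr n k → ℝ≥0∞) :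
    ∫⁻ E, ENNReal.ofReal ((volumeFactor h E)⁻¹ ^ n) * φ (map h E) ∂haar hk =
      ENNReal.ofReal (|(h : 𝔼 n →L[ℝ] 𝔼 n).det|⁻¹ ^ k) * ∫⁻ E, φ E ∂haar hk := by
  rw [← smul_eq_mul, ← lintegral_smul_measure, ← map_withDensity_volumeFactor hk h,
    lintegral_map_equiv, lintegral_withDensity_eq_lintegral_mul_non_measurable _
      (measurable_volumeFactor_inv_pow hk h)
      (Filter.Eventually.of_forall fun _ => ENNReal.ofReal_lt_top)]
  rfl

theorem realLpNorm_map (h : 𝔼 n ≃L[ℝ] 𝔼 n) (E : Gr n k) (f : 𝔼 n → ℝ) (p a : ℝ) :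
    realLpNorm (fun t : (map h E).1 => f t) p volume ^ a =
      ENNReal.ofReal (volumeFactor h E) ^ (a / p) *
        realLpNorm (fun t : E.1 => f (h t)) p volume ^ a := by
  have hne : ENNReal.ofReal (volumeFactor h E) ≠ 0 :=
    (ENNReal.ofReal_pos.2 (volumeFactor_pos h E)).ne'
  rw [realLpNorm, realLpNorm, lintegral_map_eq h E fun t => ‖f t‖ₑ ^ p, ← ENNReal.rpow_mul,
    ← ENNReal.rpow_mul, one_div_mul_eq_div, ENNReal.mul_rpow_eq_ite,
    if_neg fun hzero => hzero.1.elim (fun h => hne h.1) fun h => ENNReal.ofReal_ne_top h.1]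

theorem prod_realLpNorm_map {ι : Type*} (s : Finset ι) (h : 𝔼 n ≃L[ℝ] 𝔼 n) (E : Gr n k)
    (f : ι → 𝔼 n → ℝ) (p α : ι → ℝ) :
    ∏ i ∈ s, realLpNorm (fun t : (map h E).1 => f i t) (p i) volume ^ α i =
      ENNReal.ofReal (volumeFactor h E ^ ∑ i ∈ s, α i / p i) *
        ∏ i ∈ s, realLpNorm (fun t : E.1 => f i (h t)) (p i) volume ^ α i := by
  have hpos := volumeFactor_pos h E
  rw [Real.rpow_sum_of_pos hpos, ENNReal.ofReal_prod_of_nonneg fun i _ => by positivity,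
    ← Finset.prod_mul_distrib]
  refine Finset.prod_congr rfl fun i _ => ?_
  rw [realLpNorm_map, ENNReal.ofReal_rpow_of_pos hpos]

end Gr

theorem mainTheorem4_general {n k m : ℕ} (hk : k ≤ n) (p α : Fin m → ℝ) (_hp : ∀ i, p i ≠ 0)
    (hsum : ∑ i, α i / p i = n) (f : Fin m → 𝔼 n → ℝ) (g : 𝔼 n ≃ₗ[ℝ] 𝔼 n) :
    grassmannIntegral hk p α (fun i t => f i (g.symm t)) =
      ENNReal.ofReal (|LinearMap.det (g : 𝔼 n →ₗ[ℝ] 𝔼 n)| ^ k) * grassmannIntegral hk p α f := by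
  let h := g.symm.toContinuousLinearEquiv
  have hdet : |(h : 𝔼 n →L[ℝ] 𝔼 n).det|⁻¹ = |LinearMap.det (g : 𝔼 n →ₗ[ℝ] 𝔼 n)| := by
    rw [← abs_inv]
    exact congrArg abs (inv_eq_of_mul_eq_one_right g.det_symm_mul_det)
  rw [grassmannIntegral, grassmannIntegral, ← hdet, ← Gr.lintegral_comp_map]
  refine lintegral_congr fun E => Eq.symm ?_
  have hpos := Gr.volumeFactor_pos h E
  refine (congrArg _ (Gr.prod_realLpNorm_map Finset.univ h E f p α)).trans ?_
  rw [hsum, Real.rpow_natCast, ← mul_assoc, ← ENNReal.ofReal_mul (by positivity), ← mul_pow,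
    inv_mul_cancel₀ hpos.ne', one_pow, ENNReal.ofReal_one, one_mul]
  rfl

theorem mainTheorem4 {n k m : ℕ} (hk : k ≤ n) (hm : 1 ≤ m)
    (p α : Fin m → ℝ) (hp : ∀ i, p i ≠ 0) (hsum : ∑ i, α i / p i = n)
    (f : Fin m → EuclideanSpace ℝ (Fin n) → ℝ)
    (hbdd : ∀ i, ∃ C : ℝ, ∀ x, |f i x| ≤ C)
    (hf : ∀ i, MemRealLp (f i) (p i) volume)
    (hfin : grassmannIntegral hk p α f < ∞)
    (g : EuclideanSpace ℝ (Fin n) ≃ₗ[ℝ] EuclideanSpace ℝ (Fin n))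
    (hg : |LinearMap.det (g : EuclideanSpace ℝ (Fin n) →ₗ[ℝ] EuclideanSpace ℝ (Fin n))| = 1) :
    grassmannIntegral hk p α (fun i t => f i (g.symm t)) = grassmannIntegral hk p α f := by
  rw [mainTheorem4_general hk p α hp hsum f g, hg, one_pow, ENNReal.ofReal_one, one_mul]
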